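/- **Model.** A binary search tree (BST) stores keys from a linearly ordered set. *Splaying* a key $x$ moves its node to the root by the usual bottom-up zig, zig-zig and zig-zag steps; its cost is the number of moves from the root to $x$, i.e. the depth of $x$ before the splay. A *splay tree* answers a sequence of queries by splaying the queried keys one after the other, and the number of operations it performs is the sum of these costs. A general BST has a cursor; each operation is either a *move* of the cursor to a child or to the parent, or a *rotation* of the node at the cursor over its parent (comparisons are free). A search for $x$ starts with the cursor at the root, has the cursor at the node of $x$ at some moment, and ends with the cursor at the root. The operations may be chosen offline, knowing the whole query sequence. **Regular access with constants $k,\ell\in\mathbb N$.** For every BST $S$, every sequence $x_1,\dots,x_m$ of keys of $S$ and every sequence $y_1,\dots,y_{m+e}$ of keys of $S$ obtained from it by inserting $e\ge 0$ extra splays anywhere, if $c_1,\dots,c_m$ and $c'_1,\dots,c'_{m+e}$ are the costs of splaying these two sequences, each starting from $S$, then $$\sum_{i=1}^{m} c_i\;\le\; k\sum_{i=1}^{m+e}\bigl(\ell+c'_i\bigr).$$ **Theorem.** For all $k,\ell\in\mathbb N$ there is a constant $C$ such that the following holds for every linearly ordered set of keys on which splay trees have regular access with constants $k,\ell$. Let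 $n\ge 1$, let $S$ be a splay tree with $n+2$ keys and arbitrary initial shape, and let $T$ be a BST of arbitrary initial shape whose keys are among those of $S$. If a sequence of $m$ queries can be answered by $T$, offline, with $R$ rotations and $M$ cursor moves in total (in particular, if $T$ with these operations is an optimal offline BST for the sequence), then the splay tree $S$ answers the same sequence with at most $C\,(n+R+M)$ operations. In other words, splay trees are dynamically optimal provided that they have regular access. -/

import Mathlib

namespace SplayOpt

/-- The keys of a binary tree, read from left to right. -/
def keys {α : Type*} : BinaryTree α → List α
  | .nil => []
  | .node x a b => keys a ++ x :: keys b

/-- A binary search tree: read from left to right, the keys are strictly increasing. -/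
def IsBST {α : Type*} [LinearOrder α] (t : BinaryTree α) : Prop :=
  (keys t).Pairwise (· < ·)

/-- One step of the path from a node back to the root: the key of the parent, the sibling
subtree, and the side on which the node hangs. `left y c` says that the node is the left child of
`y`, whose right subtree is `c`; `right y c` says that the node is the right child of `y`, whose
left subtree is `c`. -/
inductive Frame (α : Type*) where
  | left (y : α) (c : BinaryTree α) : Frame α
  | right (y : α) (c : BinaryTree α) : Frame α

/-- Reattach a subtree below its parent. -/
def Frame.attach {α : Type*} : Frame α → BinaryTree α → BinaryTree α
  | .left y c, t => .node y t c
  | .right y c, t => .node y c t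

/-- A binary tree together with a cursor. The cursor is at the root of `focus`, and `path` lists
the ancestors of that node, parent first and root of the whole tree last. The cursor is at the
root of the tree `t` exactly when the configuration is `⟨t, []⟩`. -/
structure Cursor (α : Type*) where
  focus : BinaryTree α
  path : List (Frame α)

/-! ### Splay trees -/

/-- Search for `x` downwards from the cursor. -/
def locate {α : Type*} [LinearOrder α] (x : α) : BinaryTree α → List (Frame α) → Cursor α
  | .nil, p => ⟨.nil, p⟩
  | .node y a b, p =>
      if x = y then ⟨.node y a b, p⟩
      else if x < y then locate x a (.left y b :: p)
      else locate x b (.right y a :: p)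

/-- Splay the node with key `x` and subtrees `a`, `b` to the root, bottom-up along its path:
a zig when the parent is the root, otherwise a zig-zig or a zig-zag. -/
def splayUp {α : Type*} (x : α) : BinaryTree α → BinaryTree α → List (Frame α) → BinaryTree α
  | a, b, [] => .node x a b
  | a, b, [.left y c] => .node x a (.node y b c)
  | a, b, [.right y c] => .node x (.node y c a) b
  | a, b, .left y c :: .left z d :: p => splayUp x a (.node y b (.node z c d)) p
  | a, b, .right y c :: .right z d :: p => splayUp x (.node y (.node z d c) a) b p
  | a, b, .right y c :: .left z d :: p => splayUp x (.node y c a) (.node z b d) p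
  | a, b, .left y c :: .right z d :: p => splayUp x (.node z d a) (.node y b c) p

/-- The tree after splaying the key `x` (unchanged if `x` does not occur). -/
def splay {α : Type*} [LinearOrder α] (x : α) (t : BinaryTree α) : BinaryTree α :=
  match locate x t [] with
  | ⟨.nil, _⟩ => t
  | ⟨.node y a b, p⟩ => splayUp y a b p

/-- The cost of splaying `x`: the number of moves from the root to `x`, that is, its depth. -/
def splayCost {α : Type*} [LinearOrder α] (x : α) (t : BinaryTree α) : ℕ :=
  (locate x t []).path.length

/-- The total cost of splaying the keys of a list one after the other. -/
def totalSplayCost {α : Type*} [LinearOrder α] : BinaryTree α → List α → ℕ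
  | _, [] => 0
  | t, x :: xs => splayCost x t + totalSplayCost (splay x t) xs

/-- Regular access for splay trees with keys in `α`, with constants `k` and `l`: whenever the
sequence `ys` arises from `xs` by inserting extra splays anywhere, the cost of `xs` is at most `k`
times the cost of `ys`, both run from the same initial tree, where every splay of `ys` may be
charged an additional `l`. (For `l = 0` only moves are counted; the larger `l`, the weaker the
property.) -/
def RegularAccess (α : Type*) [LinearOrder α] (k l : ℕ) : Prop :=
  ∀ (S : BinaryTree α) (xs ys : List α), IsBST S → (∀ y ∈ ys, y ∈ keys S) → List.Sublist xs ys →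
    totalSplayCost S xs ≤ k * (l * ys.length + totalSplayCost S ys)

/-! ### Arbitrary (offline) binary search trees -/

/-- A single move of the cursor to an adjacent node. -/
inductive Move {α : Type*} : Cursor α → Cursor α → Prop
  | down_left (y : α) (a b : BinaryTree α) (p : List (Frame α)) (ha : a ≠ .nil) :
      Move ⟨.node y a b, p⟩ ⟨a, .left y b :: p⟩
  | down_right (y : α) (a b : BinaryTree α) (p : List (Frame α)) (hb : b ≠ .nil) :
      Move ⟨.node y a b, p⟩ ⟨b, .right y a :: p⟩
  | up (t : BinaryTree α) (f : Frame α) (p : List (Frame α)) :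
      Move ⟨t, f :: p⟩ ⟨f.attach t, p⟩

/-- A single rotation: the node at the cursor is rotated upwards, over its parent. The cursor
stays at that node. -/
inductive Rotate {α : Type*} : Cursor α → Cursor α → Prop
  | right (x y : α) (a b c : BinaryTree α) (p : List (Frame α)) :
      Rotate ⟨.node x a b, .left y c :: p⟩ ⟨.node x a (.node y b c), p⟩
  | left (x y : α) (a b c : BinaryTree α) (p : List (Frame α)) :
      Rotate ⟨.node x a b, .right y c :: p⟩ ⟨.node x (.node y c a) b, p⟩

/-- `Run c d R M`: some sequence of `R` rotations and `M` moves leads from `c` to `d`. -/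
inductive Run {α : Type*} : Cursor α → Cursor α → ℕ → ℕ → Prop
  | refl (c : Cursor α) : Run c c 0 0
  | rotate {c d e : Cursor α} {R M : ℕ} : Rotate c d → Run d e R M → Run c e (R + 1) M
  | move {c d e : Cursor α} {R M : ℕ} : Move c d → Run d e R M → Run c e R (M + 1)

/-- `Search x T T' R M`: with `R` rotations and `M` moves, a search for `x` can turn the tree `T`
into `T'`. The cursor starts at the root, is at the node with key `x` at some moment, and at the
end is back at the root. Comparisons are free. -/
def Search {α : Type*} (x : α) (T T' : BinaryTree α) (R M : ℕ) : Prop :=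
  ∃ (a b : BinaryTree α) (p : List (Frame α)) (R₁ M₁ R₂ M₂ : ℕ),
    Run ⟨T, []⟩ ⟨.node x a b, p⟩ R₁ M₁ ∧ Run ⟨.node x a b, p⟩ ⟨T', []⟩ R₂ M₂ ∧
      R = R₁ + R₂ ∧ M = M₁ + M₂

/-- `Serves T xs R M`: starting from the tree `T`, the queries `xs` can be answered one after the
other, offline, with `R` rotations and `M` moves in total. -/
inductive Serves {α : Type*} : BinaryTree α → List α → ℕ → ℕ → Prop
  | nil (T : BinaryTree α) : Serves T [] 0 0
  | cons {T T' : BinaryTree α} {x : α} {xs : List α} {R₁ M₁ R₂ M₂ : ℕ} :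
      Search x T T' R₁ M₁ → Serves T' xs R₂ M₂ → Serves T (x :: xs) (R₁ + R₂) (M₁ + M₂)

end SplayOpt

/-!
The splay tree simulates the offline tree. A configuration of the offline tree, that is, a tree with
a cursor, is represented by its *finger tree*: the node at the cursor becomes the root, its
ancestors to the left of the cursor form the left spine, its ancestors to the right the right
spine, nearest ancestors first, and every subtree keeps its place in the order of the keys. In this
representation each operation of the cursor costs a constant number of splays:

* a move to a child is a single zig-zag, which carries exactly the right subtrees along;
* a rotation after which the cursor is at the node rotated down is a single zig (`near_finger_swap`);
* a move to the parent is undone by a zig-zag, and is achieved by three splays provided that the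
  parent has an ancestor on either side (`near_zigzag_left`, `near_zigzag_right`).

The condition in the last item is needed: some three-node shapes cannot be reached by splaying. It is
met by reserving the least key `s` and the greatest key `g` of the splay tree as permanent ancestors
of everything else. The simulated tree therefore is not the given offline tree `T` but one into
which `T` embeds (`Emb`): `s` and `g` are deleted from `T`, and the keys that are missing in `T`
are filled in at empty subtrees. Deleting an extremal key turns operations into operations or into
nothing, and a search for such a key finds it next to the root of the finger tree
(`Represents.access`).

The initial shape of the splay tree does not matter. After one splay of an inner key the tree already
is the finger tree of some configuration (`exists_eq_finger`). Since the splays above work in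
both directions, linearly many of them turn any inner tree into a right path and this into any other
inner tree (`exists_splays_finger`).

Altogether the splays contain the queries as a subsequence and cost `O(n + R + M + m)` for `m` queries
(`Represents.serves`), so regular access bounds the cost of the queries alone. Finally, `m` may be
assumed to be `O(R + M + 1)`, because a query that immediately repeats its predecessor is free for
the splay tree, and any other query costs the offline tree something, up to one free query after
each of these (`Serves.exists_length_le`).
-/

namespace SplayOpt

open BinaryTree (node nil)

variable {α : Type*}

/-! ### Splaying a node given by its path -/

/-- The whole tree of a configuration with focus `t` and path `p`. -/
def zip (p : List (Frame α)) (t : BinaryTree α) : BinaryTree α :=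
  p.foldl (fun t f => f.attach t) t

theorem keys_attach_congr (f : Frame α) {t u : BinaryTree α} (h : keys t = keys u) :
    keys (f.attach t) = keys (f.attach u) := by
  cases f <;> simp [Frame.attach, keys, h]

theorem keys_zip_congr (p : List (Frame α)) {t u : BinaryTree α} (h : keys t = keys u) :
    keys (zip p t) = keys (zip p u) := by
  induction p generalizing t u with
  | nil => exact h
  | cons f p ih => exact ih (keys_attach_congr f h)

theorem zip_concat (p : List (Frame α)) (f : Frame α) (t : BinaryTree α) :
    zip (p ++ [f]) t = f.attach (zip p t) := by
  simp [zip]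

theorem mem_keys_zip (p : List (Frame α)) {t : BinaryTree α} {x : α} (h : x ∈ keys t) :
    x ∈ keys (zip p t) := by
  induction p generalizing t with
  | nil => exact h
  | cons f p ih => exact ih (by cases f <;> simp [Frame.attach, keys, h])

theorem length_path_add_le (p : List (Frame α)) (t : BinaryTree α) :
    p.length + (keys t).length ≤ (keys (zip p t)).length := by
  induction p generalizing t with
  | nil => simp [zip]
  | cons f p ih =>
    have := ih (f.attach t)
    cases f <;> simp [Frame.attach, keys, zip] at this ⊢ <;> omega

theorem exists_eq_zip {x : α} {t : BinaryTree α} (h : x ∈ keys t) :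
    ∃ a b p, t = zip p (node x a b) := by
  induction t with
  | nil => simp [keys] at h
  | node y c d ihc ihd =>
    simp only [keys, List.mem_append, List.mem_cons] at h
    rcases h with h | rfl | h
    · obtain ⟨a, b, p, rfl⟩ := ihc h
      exact ⟨a, b, p ++ [.left y d], by rw [zip_concat]; rfl⟩
    · exact ⟨c, d, [], rfl⟩
    · obtain ⟨a, b, p, rfl⟩ := ihd h
      exact ⟨a, b, p ++ [.right y c], by rw [zip_concat]; rfl⟩

theorem keys_splayUp (x : α) (a b : BinaryTree α) (p : List (Frame α)) :
    keys (splayUp x a b p) = keys (zip p (node x a b)) := by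
  fun_induction splayUp x a b p with
  | case1 => rfl
  | case2 => simp [zip, Frame.attach, keys]
  | case3 => simp [zip, Frame.attach, keys]
  | case4 a b y c z d p ih => rw [ih]; exact keys_zip_congr p (by simp [Frame.attach, keys])
  | case5 a b y c z d p ih => rw [ih]; exact keys_zip_congr p (by simp [Frame.attach, keys])
  | case6 a b y c z d p ih => rw [ih]; exact keys_zip_congr p (by simp [Frame.attach, keys])
  | case7 a b y c z d p ih => rw [ih]; exact keys_zip_congr p (by simp [Frame.attach, keys])

theorem exists_splayUp_eq_node (x : α) (a b : BinaryTree α) (p : List (Frame α)) :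
    ∃ c d, splayUp x a b p = node x c d := by
  fun_induction splayUp x a b p <;> first | exact ⟨_, _, rfl⟩ | assumption

section LinearOrder

variable [LinearOrder α]

theorem isBST_node {x : α} {a b : BinaryTree α} :
    IsBST (node x a b) ↔
      IsBST a ∧ IsBST b ∧ (∀ y ∈ keys a, y < x) ∧ (∀ y ∈ keys b, x < y) := by
  simp only [IsBST, keys, List.pairwise_append, List.pairwise_cons, List.mem_cons]
  constructor
  · rintro ⟨h₁, ⟨h₂, h₃⟩, h₄⟩
    exact ⟨h₁, h₃, fun y hy => h₄ y hy x (.inl rfl), h₂⟩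
  · rintro ⟨h₁, h₂, h₃, h₄⟩
    refine ⟨h₁, ⟨h₄, h₂⟩, ?_⟩
    rintro y hy z (rfl | hz)
    · exact h₃ y hy
    · exact (h₃ y hy).trans (h₄ z hz)

theorem IsBST.congr {t u : BinaryTree α} (h : IsBST t) (hk : keys u = keys t) : IsBST u := by
  unfold IsBST at *; rwa [hk]

theorem locate_zip {x : α} {a b : BinaryTree α} (p q : List (Frame α))
    (h : IsBST (zip p (node x a b))) :
    locate x (zip p (node x a b)) q = ⟨node x a b, p ++ q⟩ := by
  induction p using List.reverseRecOn generalizing q with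
  | nil => simp [zip, locate]
  | append_singleton p f ih =>
    have hx : x ∈ keys (zip p (node x a b)) := mem_keys_zip p (by simp [keys])
    rw [zip_concat] at h ⊢
    cases f with
    | left y c =>
      obtain ⟨h₁, -, h₂, -⟩ := isBST_node.1 h
      have := h₂ x hx
      simp [Frame.attach, locate, this.ne, this, ih _ h₁]
    | right y c =>
      obtain ⟨-, h₁, -, h₂⟩ := isBST_node.1 h
      have := h₂ x hx
      simp [Frame.attach, locate, this.ne', this.not_gt, ih _ h₁]

theorem splay_zip {x : α} {a b : BinaryTree α} {p : List (Frame α)}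
    (h : IsBST (zip p (node x a b))) : splay x (zip p (node x a b)) = splayUp x a b p := by
  simp [splay, locate_zip p [] h]

theorem splayCost_zip {x : α} {a b : BinaryTree α} {p : List (Frame α)}
    (h : IsBST (zip p (node x a b))) : splayCost x (zip p (node x a b)) = p.length := by
  simp [splayCost, locate_zip p [] h]

theorem keys_splay {x : α} {t : BinaryTree α} (h : IsBST t) (hx : x ∈ keys t) :
    keys (splay x t) = keys t := by
  obtain ⟨a, b, p, rfl⟩ := exists_eq_zip hx
  rw [splay_zip h, keys_splayUp]

theorem exists_splay_eq_node {x : α} {t : BinaryTree α} (h : IsBST t) (hx : x ∈ keys t) :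
    ∃ a b, splay x t = node x a b := by
  obtain ⟨a, b, p, rfl⟩ := exists_eq_zip hx
  rw [splay_zip h]
  exact exists_splayUp_eq_node x a b p

/-! ### Cheap sequences of splays -/

/-- The tree after splaying the keys of a list one after the other. -/
def splayAll : List α → BinaryTree α → BinaryTree α
  | [], t => t
  | x :: xs, t => splayAll xs (splay x t)

theorem splayAll_append (xs ys : List α) (t : BinaryTree α) :
    splayAll (xs ++ ys) t = splayAll ys (splayAll xs t) := by
  induction xs generalizing t with
  | nil => rfl
  | cons x xs ih => exact ih _

theorem totalSplayCost_append (xs ys : List α) (t : BinaryTree α) :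
    totalSplayCost t (xs ++ ys) = totalSplayCost t xs + totalSplayCost (splayAll xs t) ys := by
  induction xs generalizing t with
  | nil => simp [totalSplayCost, splayAll]
  | cons x xs ih => simp [totalSplayCost, splayAll, ih, add_assoc]

/-- Some sequence of splays with keys of `t` turns `t` into `u`, contains `xs` as a subsequence,
and costs at most `N` when every splay is charged its number of moves plus one. -/
def Splays (xs : List α) (N : ℕ) (t u : BinaryTree α) : Prop :=
  keys u = keys t ∧ ∃ ys, xs.Sublist ys ∧ (∀ y ∈ ys, y ∈ keys t) ∧ splayAll ys t = u ∧
    ys.length + totalSplayCost t ys ≤ N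

theorem Splays.refl (t : BinaryTree α) : Splays [] 0 t t :=
  ⟨rfl, [], .slnil, by simp, rfl, by simp [totalSplayCost]⟩

theorem Splays.trans {xs xs' : List α} {N N' : ℕ} {t u v : BinaryTree α}
    (h : Splays xs N t u) (h' : Splays xs' N' u v) : Splays (xs ++ xs') (N + N') t v := by
  obtain ⟨hk, ys, hs, hm, rfl, hc⟩ := h
  obtain ⟨hk', ys', hs', hm', rfl, hc'⟩ := h'
  refine ⟨hk'.trans hk, ys ++ ys', hs.append hs', ?_, splayAll_append _ _ _, ?_⟩
  · intro y hy
    rcases List.mem_append.1 hy with hy | hy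
    · exact hm y hy
    · exact hk ▸ hm' y hy
  · rw [totalSplayCost_append, List.length_append]
    omega

theorem Splays.mono {xs xs' : List α} {N N' : ℕ} {t u : BinaryTree α}
    (h : Splays xs N t u) (hxs : xs'.Sublist xs) (hN : N ≤ N') : Splays xs' N' t u := by
  obtain ⟨hk, ys, hs, hm, hu, hc⟩ := h
  exact ⟨hk, ys, hxs.trans hs, hm, hu, hc.trans hN⟩

theorem Splays.isBST {xs : List α} {N : ℕ} {t u : BinaryTree α} (h : Splays xs N t u)
    (ht : IsBST t) : IsBST u :=
  ht.congr h.1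

theorem splays_zip {x : α} {a b : BinaryTree α} (p : List (Frame α))
    (h : IsBST (zip p (node x a b))) :
    Splays [x] (p.length + 1) (zip p (node x a b)) (splayUp x a b p) := by
  refine ⟨keys_splayUp x a b p, [x], List.Sublist.refl _, ?_, splay_zip h, ?_⟩
  · intro y hy
    rw [List.mem_singleton.1 hy]
    exact mem_keys_zip p (by simp [keys])
  · simp [totalSplayCost, splayCost_zip h, add_comm]

/-- Two trees with the same keys, each of which arises from the other by splays of cost at
most `N`. -/
def Near (N : ℕ) (t u : BinaryTree α) : Prop :=
  keys u = keys t ∧ (IsBST t → Splays [] N t u ∧ Splays [] N u t)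

theorem Near.refl (N : ℕ) (t : BinaryTree α) : Near N t t :=
  ⟨rfl, fun _ => ⟨(Splays.refl t).mono (List.Sublist.refl _) N.zero_le,
    (Splays.refl t).mono (List.Sublist.refl _) N.zero_le⟩⟩

theorem Near.symm {N : ℕ} {t u : BinaryTree α} (h : Near N t u) : Near N u t :=
  ⟨h.1.symm, fun hu => (h.2 (hu.congr h.1.symm)).symm⟩

theorem Near.trans {N N' : ℕ} {t u v : BinaryTree α} (h : Near N t u) (h' : Near N' u v) :
    Near (N + N') t v := by
  refine ⟨h'.1.trans h.1, fun ht => ?_⟩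
  obtain ⟨h₁, h₂⟩ := h.2 ht
  obtain ⟨h₃, h₄⟩ := h'.2 (ht.congr h.1)
  exact ⟨h₁.trans h₃, (h₄.trans h₂).mono (List.Sublist.refl _) (by omega)⟩

theorem Near.mono {N N' : ℕ} {t u : BinaryTree α} (h : Near N t u) (hN : N ≤ N') :
    Near N' t u :=
  ⟨h.1, fun ht => ⟨(h.2 ht).1.mono (List.Sublist.refl _) hN,
    (h.2 ht).2.mono (List.Sublist.refl _) hN⟩⟩

/-- Splaying a child of the root is a single rotation, and splaying the former root undoes it. -/
theorem near_zig (x y : α) (a b c : BinaryTree α) :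
    Near 2 (node y (node x a b) c) (node x a (node y b c)) := by
  have hk : keys (node x a (node y b c)) = keys (node y (node x a b) c) := by simp [keys]
  exact ⟨hk, fun h => ⟨(splays_zip [.left y c] h).mono (List.nil_sublist _) le_rfl,
    (splays_zip [.right x a] (h.congr hk)).mono (List.nil_sublist _) le_rfl⟩⟩

/-- The finger trees before and after a move of the cursor from `x` to its left child `y`. The move
down is a zig-zag; for the move back, the ancestors `l` and `r` on both sides are needed. -/
theorem near_zigzag_left (l r x y : α) (l' r' a₁ a₂ b : BinaryTree α) :
    Near 9 (node x (node l l' (node y a₁ a₂)) (node r b r'))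
      (node y (node l l' a₁) (node x a₂ (node r b r'))) := by
  have hk : keys (node y (node l l' a₁) (node x a₂ (node r b r'))) =
    keys (node x (node l l' (node y a₁ a₂)) (node r b r')) := by simp [keys]
  refine ⟨hk, fun h => ⟨?_, ?_⟩⟩
  · exact (splays_zip [.right l l', .left x (node r b r')] h).mono (List.nil_sublist _)
      (by simp)
  · -- The keys `l`, `r` and `x` are splayed in this order.
    have h₁ : Splays [l] 2 _ (node l l' (node y a₁ (node x a₂ (node r b r')))) :=
      splays_zip [.left y (node x a₂ (node r b r'))] (h.congr hk)
    have h₂ : Splays [r] 4 _ (node r (node l l' (node x (node y a₁ a₂) b)) r') :=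
      splays_zip [.right x a₂, .right y a₁, .right l l'] (h₁.isBST (h.congr hk))
    have h₃ : Splays [x] 3 _ (node x (node l l' (node y a₁ a₂)) (node r b r')) :=
      splays_zip [.right l l', .left r r'] (h₂.isBST (h₁.isBST (h.congr hk)))
    exact ((h₁.trans h₂).trans h₃).mono (List.nil_sublist _) (by simp)

/-- The mirror image of `near_zigzag_left`. -/
theorem near_zigzag_right (l r x y : α) (l' r' a b₁ b₂ : BinaryTree α) :
    Near 9 (node x (node l l' a) (node r (node y b₁ b₂) r'))
      (node y (node x (node l l' a) b₁) (node r b₂ r')) := by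
  have hk : keys (node y (node x (node l l' a) b₁) (node r b₂ r')) =
    keys (node x (node l l' a) (node r (node y b₁ b₂) r')) := by simp [keys]
  refine ⟨hk, fun h => ⟨?_, ?_⟩⟩
  · exact (splays_zip [.left r r', .right x (node l l' a)] h).mono (List.nil_sublist _)
      (by simp)
  · have h₁ : Splays [r] 2 _ (node r (node y (node x (node l l' a) b₁) b₂) r') :=
      splays_zip [.right y (node x (node l l' a) b₁)] (h.congr hk)
    have h₂ : Splays [l] 4 _ (node l l' (node r (node x a (node y b₁ b₂)) r')) :=
      splays_zip [.left x b₁, .left y b₂, .left r r'] (h₁.isBST (h.congr hk))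
    have h₃ : Splays [x] 3 _ (node x (node l l' a) (node r (node y b₁ b₂) r')) :=
      splays_zip [.left r r', .right l l'] (h₂.isBST (h₁.isBST (h.congr hk)))
    exact ((h₁.trans h₂).trans h₃).mono (List.nil_sublist _) (by simp)

end LinearOrder

/-! ### The finger tree of a configuration -/

/-- The nearest ancestor to the left of the cursor, together with the left subtree that it has in
the finger tree: a left spine that consists of the further left ancestors, nearest first. The
sentinel `s` serves as the outermost left ancestor. -/
def leftSpine (s : α) : List (Frame α) → α × BinaryTree α
  | [] => (s, nil)
  | .left _ _ :: p => leftSpine s p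
  | .right y c :: p => (y, node (leftSpine s p).1 (leftSpine s p).2 c)

/-- The mirror image of `leftSpine`, with the outermost right ancestor `g`. -/
def rightSpine (g : α) : List (Frame α) → α × BinaryTree α
  | [] => (g, nil)
  | .left y c :: p => (y, node (rightSpine g p).1 c (rightSpine g p).2)
  | .right _ _ :: p => rightSpine g p

/-- The finger tree with focus `t`, nearest left ancestor `l` and nearest right ancestor `r`, whose
outer subtrees are `l'` and `r'`. The root is the root of the focus; if the focus is empty, it
is `l`. -/
def fingerAt (l r : α × BinaryTree α) : BinaryTree α → BinaryTree α
  | nil => node l.1 l.2 (node r.1 nil r.2)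
  | node x a b => node x (node l.1 l.2 a) (node r.1 b r.2)

/-- The finger tree of a configuration: the node at the cursor is the root, the left spine below it
consists of the ancestors to its left, nearest first, the right spine of the ancestors to its
right, and two sentinels `s` and `g` end these spines. -/
def finger (s g : α) (t : BinaryTree α) (p : List (Frame α)) : BinaryTree α :=
  fingerAt (leftSpine s p) (rightSpine g p) t

theorem keys_fingerAt (l r : α × BinaryTree α) (t : BinaryTree α) :
    keys (fingerAt l r t) = keys l.2 ++ l.1 :: (keys t ++ r.1 :: keys r.2) := by
  cases t <;> simp [fingerAt, keys]

theorem keys_finger (s g : α) (t : BinaryTree α) (p : List (Frame α)) :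
    keys (finger s g t p) = s :: (keys (zip p t) ++ [g]) := by
  induction p generalizing t with
  | nil => simp [finger, keys_fingerAt, leftSpine, rightSpine, zip, keys]
  | cons f p ih =>
    have h := ih (f.attach t)
    change _ = s :: (keys (zip p (f.attach t)) ++ [g])
    rw [← h]
    cases f <;> simp [finger, keys_fingerAt, leftSpine, rightSpine, Frame.attach, keys]

theorem exists_leftSpine (q : List (Frame α)) {s : α} (g l : α) (l' : BinaryTree α)
    {u v : List α} (hs : leftSpine s q = (s, nil)) (h : keys l' ++ l :: u = s :: v) :
    ∃ p, leftSpine s p = (l, l') ∧ rightSpine g p = rightSpine g q := by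
  induction l' generalizing l u with
  | nil =>
    simp only [keys, List.nil_append, List.cons.injEq] at h
    exact ⟨q, by rw [hs, h.1], rfl⟩
  | node y a b iha =>
    obtain ⟨p, h₁, h₂⟩ := iha y (u := keys b ++ l :: u) (by simpa [keys] using h)
    exact ⟨.right l b :: p, by simp [leftSpine, h₁], h₂⟩

theorem exists_rightSpine (s : α) {g : α} (r : α) (r' : BinaryTree α) {u v : List α}
    (h : u ++ r :: keys r' = v ++ [g]) :
    ∃ p, leftSpine s p = (s, nil) ∧ rightSpine g p = (r, r') := by
  induction r' generalizing r u with
  | nil =>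
    have := List.append_inj_right' h rfl
    simp only [List.cons.injEq] at this
    exact ⟨[], rfl, by rw [this.1]; rfl⟩
  | node y a b _ ihb =>
    obtain ⟨p, h₁, h₂⟩ := ihb y (u := u ++ r :: keys a) (by simpa [keys] using h)
    exact ⟨.left r a :: p, h₁, by simp [rightSpine, h₂]⟩

/-- Every tree whose root is neither its least nor its greatest key is the finger tree of some
configuration. -/
theorem exists_eq_finger {s g x : α} {A B : BinaryTree α} {K : List α}
    (h : keys (node x A B) = s :: (K ++ [g])) (hA : A ≠ nil) (hB : B ≠ nil) :
    ∃ t p, node x A B = finger s g t p := by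
  cases A with
  | nil => exact absurd rfl hA
  | node l l' a =>
  cases B with
  | nil => exact absurd rfl hB
  | node r b r' =>
  obtain ⟨q, hq, hq'⟩ := exists_rightSpine s (g := g) r r' (v := s :: K)
    (u := keys l' ++ l :: (keys a ++ x :: keys b)) (by simpa [keys] using h)
  obtain ⟨p, hp, hp'⟩ := exists_leftSpine q g l l'
    (u := keys a ++ x :: (keys b ++ r :: keys r')) hq (by simpa [keys] using h)
  exact ⟨node x a b, p, by simp [finger, fingerAt, hp, hp', hq']⟩

theorem near_finger_left [LinearOrder α] (s g y : α) (a b : BinaryTree α) (p : List (Frame α)) :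
    Near 9 (finger s g (node y a b) p) (finger s g a (.left y b :: p)) := by
  cases a with
  | nil => exact (near_zig _ _ _ _ _).mono (by norm_num)
  | node x a₁ a₂ => exact near_zigzag_left _ _ _ _ _ _ _ _ _

theorem near_finger_right [LinearOrder α] (s g y : α) (a b : BinaryTree α) (p : List (Frame α)) :
    Near 9 (finger s g (node y a b) p) (finger s g b (.right y a :: p)) := by
  cases b with
  | nil => exact Near.refl _ _
  | node x a₁ a₂ => exact near_zigzag_right _ _ _ _ _ _ _ _ _

theorem near_finger_attach [LinearOrder α] (s g : α) (t : BinaryTree α) (f : Frame α)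
    (p : List (Frame α)) :
    Near 9 (finger s g (f.attach t) p) (finger s g t (f :: p)) := by
  cases f
  · exact near_finger_left _ _ _ _ _ _
  · exact near_finger_right _ _ _ _ _ _

theorem near_finger_zip [LinearOrder α] (s g : α) (t : BinaryTree α) (p : List (Frame α)) :
    Near (9 * p.length) (finger s g t p) (finger s g (zip p t) []) := by
  induction p generalizing t with
  | nil => exact Near.refl _ _
  | cons f p ih =>
    exact ((near_finger_attach s g t f p).symm.trans (ih (f.attach t))).mono
      (by simp only [List.length_cons]; omega)

/-- A rotation of `x` over its parent `y`, followed by a move of the cursor to `y`, is a single zig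
in the finger tree. -/
theorem near_finger_swap [LinearOrder α] (s g x y : α) (a b c : BinaryTree α) (p : List (Frame α)) :
    Near 2 (finger s g (node x a b) (.left y c :: p))
      (finger s g (node y b c) (.right x a :: p)) :=
  (near_zig _ _ _ _ _).symm

theorem near_finger_rotate_right [LinearOrder α] (s g x y : α) (a b c : BinaryTree α)
    (p : List (Frame α)) :
    Near 18 (finger s g (node x a b) (.left y c :: p))
      (finger s g (node x a (node y b c)) p) :=
  ((near_finger_swap s g x y a b c p).trans (near_finger_right s g x a _ p).symm).mono (by simp)

theorem near_finger_rotate_left [LinearOrder α] (s g x y : α) (a b c : BinaryTree α)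
    (p : List (Frame α)) :
    Near 18 (finger s g (node x a b) (.right y c :: p))
      (finger s g (node x (node y c a) b) p) :=
  ((near_finger_swap s g y x c a b p).symm.trans (near_finger_left s g x _ b p).symm).mono
    (by simp)

/-! ### Reshaping the focus -/

/-- The tree with the keys of a list in which no node has a left child. -/
def rightPath : List α → BinaryTree α
  | [] => nil
  | x :: xs => node x nil (rightPath xs)

theorem keys_rightPath (xs : List α) : keys (rightPath xs) = xs := by
  induction xs with
  | nil => rfl
  | cons x xs ih => simp [rightPath, keys, ih]

/-- The potential that pays for turning a tree into a right path: a node on the right spine weighs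
one, any other node two, so that each rotation towards the right spine lowers it by one. -/
def flattenPotential : BinaryTree α → ℕ
  | nil => 0
  | node _ a b => 2 * (keys a).length + 1 + flattenPotential b

theorem flattenPotential_le (t : BinaryTree α) : flattenPotential t ≤ 2 * (keys t).length := by
  induction t with
  | nil => simp [flattenPotential]
  | node x a b _ ih => simp [flattenPotential, keys]; omega

theorem near_finger_rightPath [LinearOrder α] (s g : α) (t : BinaryTree α) (p : List (Frame α)) :
    Near (27 * flattenPotential t) (finger s g t p) (finger s g (rightPath (keys t)) p) := by
  match t with
  | nil => exact Near.refl _ _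
  | node x nil b =>
    have h := ((near_finger_right s g x nil b p).trans
      (near_finger_rightPath s g b (.right x nil :: p))).trans
      (near_finger_right s g x nil (rightPath (keys b)) p).symm
    exact h.mono (by simp [flattenPotential, keys]; omega)
  | node x (node y a₁ a₂) b =>
    have h := ((near_finger_left s g x (node y a₁ a₂) b p).trans
      (near_finger_rotate_right s g y x a₁ a₂ b p)).trans
      (near_finger_rightPath s g (node y a₁ (node x a₂ b)) p)
    have hk : keys (node y a₁ (node x a₂ b)) = keys (node x (node y a₁ a₂) b) := by simp [keys]
    rw [hk] at h
    exact h.mono (by simp [flattenPotential, keys]; omega)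
termination_by flattenPotential t
decreasing_by
  · simp [flattenPotential]
  · simp [flattenPotential, keys]; omega

theorem near_finger_of_keys_eq [LinearOrder α] (s g : α) {t u : BinaryTree α} (p : List (Frame α))
    (h : keys t = keys u) :
    Near (108 * (keys t).length) (finger s g t p) (finger s g u p) := by
  have h₁ := near_finger_rightPath s g t p
  have h₂ := (near_finger_rightPath s g u p).symm
  rw [← h] at h₂
  have h₃ := flattenPotential_le t
  have h₄ := flattenPotential_le u
  rw [← h] at h₄
  exact (h₁.trans h₂).mono (by omega)

/-- A tree with at least one key besides its least key `s` and its greatest key `g` becomes, at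
linear cost, the finger tree of any tree with these other keys. -/
theorem exists_splays_finger [LinearOrder α] {s g : α} {K : List α} {S t : BinaryTree α}
    (hS : IsBST S)
    (hK : K ≠ []) (hkS : keys S = s :: (K ++ [g])) (ht : keys t = K) :
    Splays [] (118 * (K.length + 2)) S (finger s g t []) := by
  obtain ⟨x, K', rfl⟩ := List.exists_cons_of_ne_nil hK
  have hx : x ∈ keys S := by simp [hkS]
  obtain ⟨a, b, p, rfl⟩ := exists_eq_zip hx
  have h₁ := splays_zip p hS
  obtain ⟨A, B, hAB⟩ := exists_splayUp_eq_node x a b p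
  rw [hAB] at h₁
  have hk₁ := h₁.1.trans hkS
  have hB₁ := h₁.isBST hS
  have hA : A ≠ nil := by
    rintro rfl
    -- Otherwise `x` would be the least key.
    have hp : (s :: (x :: K' ++ [g])).Pairwise (· < ·) := hkS ▸ hS
    simp only [keys, List.nil_append, List.cons.injEq] at hk₁
    exact absurd hk₁.1 ((List.rel_of_pairwise_cons hp (by simp)).ne')
  have hB : B ≠ nil := by
    rintro rfl
    -- Otherwise `x` would be the greatest key.
    have hp : (s :: (x :: K' ++ [g])).Pairwise (· < ·) := hkS ▸ hS
    have hxg : x = g := by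
      have h : keys A ++ [x] = (s :: x :: K') ++ [g] := hk₁
      exact (List.cons.inj (List.append_inj_right' h rfl)).1
    exact absurd hxg ((List.rel_of_pairwise_cons hp.tail (by simp)).ne)
  obtain ⟨u, q, huq⟩ := exists_eq_finger hk₁ hA hB
  rw [huq] at h₁ hk₁ hB₁
  rw [keys_finger] at hk₁
  have hkz : keys (zip q u) = x :: K' := List.append_cancel_right (List.cons.inj hk₁).2
  have h₂ := (near_finger_zip s g u q).trans
    (near_finger_of_keys_eq s g [] (hkz.trans ht.symm))
  have hl := length_path_add_le p (node x a b)
  have hl' := length_path_add_le q u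
  rw [hkS] at hl
  rw [hkz] at hl'
  refine (h₁.trans (h₂.2 hB₁).1).mono (List.nil_sublist _) ?_
  rw [hkz]
  simp only [List.length_cons, List.length_append, List.length_nil] at hl hl' ⊢
  omega

/-! ### Embedding a tree into one without extremal keys -/

/-- `Emb s g lb rb t u`: the tree `u` arises from `t` by deleting the least key `s` and the greatest
key `g` of the whole tree and by filling the empty subtrees arbitrarily. The flags `lb` and `rb`
tell whether `t` reaches the left and the right end of the whole tree, that is, whether `s` and
`g` may be deleted from it. -/
inductive Emb (s g : α) : Bool → Bool → BinaryTree α → BinaryTree α → Prop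
  | nil (lb rb : Bool) (u : BinaryTree α) : Emb s g lb rb nil u
  | node {lb rb : Bool} (x : α) {a b a' b' : BinaryTree α} : Emb s g lb false a a' →
      Emb s g false rb b b' → Emb s g lb rb (node x a b) (node x a' b')
  | min {rb : Bool} {b b' : BinaryTree α} : Emb s g false rb b b' →
      Emb s g true rb (node s nil b) b'
  | max {lb : Bool} {a a' : BinaryTree α} : Emb s g lb false a a' →
      Emb s g lb true (node g a nil) a'

/-- The counterpart of `Emb` for paths. The flags are those of the subtree at the end of the
path. -/
inductive EmbPath (s g : α) : Bool → Bool → List (Frame α) → List (Frame α) → Prop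
  | nil : EmbPath s g true true [] []
  | left {lb rb : Bool} (y : α) {c c' : BinaryTree α} {p p' : List (Frame α)} :
      EmbPath s g lb rb p p' → Emb s g false rb c c' →
      EmbPath s g lb false (.left y c :: p) (.left y c' :: p')
  | right {lb rb : Bool} (y : α) {c c' : BinaryTree α} {p p' : List (Frame α)} :
      EmbPath s g lb rb p p' → Emb s g lb false c c' →
      EmbPath s g false rb (.right y c :: p) (.right y c' :: p')
  | min {rb : Bool} {p p' : List (Frame α)} : EmbPath s g true rb p p' →
      EmbPath s g false rb (.right s BinaryTree.nil :: p) p'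
  | max {lb : Bool} {p p' : List (Frame α)} : EmbPath s g lb true p p' →
      EmbPath s g lb false (.left g BinaryTree.nil :: p) p'

theorem EmbPath.leftSpine_eq {s g : α} {rb : Bool} {p p' : List (Frame α)}
    (h : EmbPath s g true rb p p') : leftSpine s p' = (s, BinaryTree.nil) := by
  generalize hlb : true = lb at h
  induction h with
  | nil => rfl
  | left _ _ _ ih => exact ih hlb
  | right => cases hlb
  | min => cases hlb
  | max _ ih => exact ih hlb

theorem EmbPath.rightSpine_eq {s g : α} {lb : Bool} {p p' : List (Frame α)}
    (h : EmbPath s g lb true p p') : rightSpine g p' = (g, BinaryTree.nil) := by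
  generalize hrb : true = rb at h
  induction h with
  | nil => rfl
  | left => cases hrb
  | right _ _ _ ih => exact ih hrb
  | min _ ih => exact ih hrb
  | max => cases hrb

/-- The splay tree `u` represents the configuration `c`: it is the finger tree of a configuration
into which `c` embeds. -/
def Represents (s g : α) (c : Cursor α) (u : BinaryTree α) : Prop :=
  ∃ lb rb t p, Emb s g lb rb c.focus t ∧ EmbPath s g lb rb c.path p ∧ u = finger s g t p

theorem exists_emb [LinearOrder α] {s g : α} (hsg : s < g) {T : BinaryTree α} (hT : IsBST T)
    (lb rb : Bool)
    {K : List α} (hK : K.Pairwise (· < ·)) (hs : ∀ y ∈ K, s < y) (hg : ∀ y ∈ K, y < g)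
    (hTK : ∀ y ∈ keys T, y ∈ K ∨ (lb = true ∧ y = s) ∨ (rb = true ∧ y = g)) :
    ∃ t, Emb s g lb rb T t ∧ keys t = K := by
  induction T generalizing lb rb K with
  | nil => exact ⟨rightPath K, .nil _ _ _, keys_rightPath K⟩
  | node x a b iha ihb =>
    obtain ⟨ha, hb, hax, hbx⟩ := isBST_node.1 hT
    have hTa : ∀ y ∈ keys a, y ∈ K ∨ (lb = true ∧ y = s) ∨ (rb = true ∧ y = g) :=
      fun y hy => hTK y (by simp [keys, hy])
    have hTb : ∀ y ∈ keys b, y ∈ K ∨ (lb = true ∧ y = s) ∨ (rb = true ∧ y = g) :=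
      fun y hy => hTK y (by simp [keys, hy])
    have hle : ∀ y, y ∈ K ∨ (lb = true ∧ y = s) ∨ (rb = true ∧ y = g) → s ≤ y ∧ y ≤ g := by
      rintro y (hy | ⟨-, rfl⟩ | ⟨-, rfl⟩)
      · exact ⟨(hs y hy).le, (hg y hy).le⟩
      · exact ⟨le_rfl, hsg.le⟩
      · exact ⟨hsg.le, le_rfl⟩
    rcases hTK x (by simp [keys]) with hx | ⟨rfl, rfl⟩ | ⟨rfl, rfl⟩
    · obtain ⟨K₁, K₂, rfl⟩ := List.append_of_mem hx
      obtain ⟨hK₁, hK₂, hK₁₂⟩ := List.pairwise_append.1 hK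
      obtain ⟨hxK₂, hK₂⟩ := List.pairwise_cons.1 hK₂
      have hxs := hs x hx
      have hxg := hg x hx
      obtain ⟨a', hea, hka⟩ := iha ha lb false hK₁ (fun y hy => hs y (by simp [hy]))
        (fun y hy => hg y (by simp [hy])) (by
          intro y hy
          have hyx := hax y hy
          rcases hTa y hy with h | h | h
          · rcases List.mem_append.1 h with h | h
            · exact .inl h
            · rcases List.mem_cons.1 h with rfl | h
              · exact absurd hyx (lt_irrefl _)
              · exact absurd hyx (hxK₂ y h).not_gt
          · exact .inr (.inl h)
          · exact absurd (h.2 ▸ hyx) hxg.not_gt)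
      obtain ⟨b', heb, hkb⟩ := ihb hb false rb hK₂ (fun y hy => hs y (by simp [hy]))
        (fun y hy => hg y (by simp [hy])) (by
          intro y hy
          have hyx := hbx y hy
          rcases hTb y hy with h | h | h
          · rcases List.mem_append.1 h with h | h
            · exact absurd hyx (hK₁₂ y h x (by simp)).not_gt
            · rcases List.mem_cons.1 h with rfl | h
              · exact absurd hyx (lt_irrefl _)
              · exact .inl h
          · exact absurd (h.2 ▸ hyx) hxs.not_gt
          · exact .inr (.inr h))
      exact ⟨node x a' b', .node x hea heb, by simp [keys, hka, hkb]⟩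
    · cases a with
      | node y c d =>
        have hy : y ∈ keys (node y c d) := by simp [keys]
        exact absurd (hax y hy) (hle y (hTa y hy)).1.not_gt
      | nil =>
        obtain ⟨b', heb, hkb⟩ := ihb hb false rb hK hs hg (by
          intro y hy
          rcases hTb y hy with h | h | h
          · exact .inl h
          · exact absurd h.2 (hbx y hy).ne'
          · exact .inr (.inr h))
        exact ⟨b', .min heb, hkb⟩
    · cases b with
      | node y c d =>
        have hy : y ∈ keys (node y c d) := by simp [keys]
        exact absurd (hbx y hy) (hle y (hTb y hy)).2.not_gt
      | nil =>
        obtain ⟨a', hea, hka⟩ := iha ha lb false hK hs hg (by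
          intro y hy
          rcases hTa y hy with h | h | h
          · exact .inl h
          · exact .inr (.inl h)
          · exact absurd h.2 (hax y hy).ne)
        exact ⟨a', .max hea, hka⟩

/-! ### Simulating moves, rotations and searches -/

theorem Represents.move [LinearOrder α] {s g : α} {c d : Cursor α} {u : BinaryTree α}
    (h : Represents s g c u)
    (hcd : Move c d) : ∃ v, Represents s g d v ∧ Near 18 u v := by
  obtain ⟨lb, rb, t, p, ht, hp, rfl⟩ := h
  cases hcd with
  | down_left y a b q ha =>
    cases ht with
    | node _ ha' hb' =>
      exact ⟨_, ⟨_, _, _, _, ha', .left y hp hb', rfl⟩,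
        (near_finger_left _ _ _ _ _ _).mono (by simp)⟩
    | min => exact absurd rfl ha
    | max ha' => exact ⟨_, ⟨_, _, _, _, ha', .max hp, rfl⟩, Near.refl _ _⟩
  | down_right y a b q hb =>
    cases ht with
    | node _ ha' hb' =>
      exact ⟨_, ⟨_, _, _, _, hb', .right y hp ha', rfl⟩,
        (near_finger_right _ _ _ _ _ _).mono (by simp)⟩
    | min hb' => exact ⟨_, ⟨_, _, _, _, hb', .min hp, rfl⟩, Near.refl _ _⟩
    | max => exact absurd rfl hb
  | up t' f q =>
    cases hp with
    | left y hp hc =>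
      exact ⟨_, ⟨_, _, _, _, .node y ht hc, hp, rfl⟩,
        (near_finger_left _ _ _ _ _ _).symm.mono (by simp)⟩
    | right y hp hc =>
      exact ⟨_, ⟨_, _, _, _, .node y hc ht, hp, rfl⟩,
        (near_finger_right _ _ _ _ _ _).symm.mono (by simp)⟩
    | min hp => exact ⟨_, ⟨_, _, _, _, .min ht, hp, rfl⟩, Near.refl _ _⟩
    | max hp => exact ⟨_, ⟨_, _, _, _, .max ht, hp, rfl⟩, Near.refl _ _⟩

theorem Represents.rotate [LinearOrder α] {s g : α} {c d : Cursor α} {u : BinaryTree α}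
    (h : Represents s g c u) (hcd : Rotate c d) : ∃ v, Represents s g d v ∧ Near 18 u v := by
  obtain ⟨lb, rb, t, p, ht, hp, rfl⟩ := h
  cases hcd with
  | right x y a b c q =>
    cases hp with
    | left _ hp hc =>
      cases ht with
      | node _ ha hb =>
        exact ⟨_, ⟨_, _, _, _, .node x ha (.node y hb hc), hp, rfl⟩,
          near_finger_rotate_right _ _ _ _ _ _ _ _⟩
      | min hb =>
        exact ⟨_, ⟨_, _, _, _, .min (.node y hb hc), hp, rfl⟩,
          (near_finger_left _ _ _ _ _ _).symm.mono (by simp)⟩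
    | max hp =>
      cases ht with
      | node _ ha hb =>
        exact ⟨_, ⟨_, _, _, _, .node x ha (.max hb), hp, rfl⟩, Near.refl _ _⟩
      | min hb => exact ⟨_, ⟨_, _, _, _, .min (.max hb), hp, rfl⟩, Near.refl _ _⟩
  | left x y a b c q =>
    cases hp with
    | right _ hp hc =>
      cases ht with
      | node _ ha hb =>
        exact ⟨_, ⟨_, _, _, _, .node x (.node y hc ha) hb, hp, rfl⟩,
          near_finger_rotate_left _ _ _ _ _ _ _ _⟩
      | max ha =>
        exact ⟨_, ⟨_, _, _, _, .max (.node y hc ha), hp, rfl⟩,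
          (near_finger_right _ _ _ _ _ _).symm.mono (by simp)⟩
    | min hp =>
      cases ht with
      | node _ ha hb =>
        exact ⟨_, ⟨_, _, _, _, .node x (.min ha) hb, hp, rfl⟩, Near.refl _ _⟩
      | max ha => exact ⟨_, ⟨_, _, _, _, .max (.min ha), hp, rfl⟩, Near.refl _ _⟩

theorem Represents.run [LinearOrder α] {s g : α} {c d : Cursor α} {R M : ℕ} (hcd : Run c d R M)
    {u : BinaryTree α} (h : Represents s g c u) :
    ∃ v, Represents s g d v ∧ Near (18 * (R + M)) u v := by
  induction hcd generalizing u with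
  | refl c => exact ⟨u, h, Near.refl _ _⟩
  | rotate h₁ _ ih =>
    obtain ⟨v, hv, huv⟩ := h.rotate h₁
    obtain ⟨w, hw, hvw⟩ := ih hv
    exact ⟨w, hw, (huv.trans hvw).mono (by omega)⟩
  | move h₁ _ ih =>
    obtain ⟨v, hv, huv⟩ := h.move h₁
    obtain ⟨w, hw, hvw⟩ := ih hv
    exact ⟨w, hw, (huv.trans hvw).mono (by omega)⟩

/-- The key at the cursor can be splayed at constant cost, without a lasting change of the finger
tree: the key is the root, or a deleted extremal key, which ends a spine of length one. -/
theorem Represents.access [LinearOrder α] {s g x : α} {a b : BinaryTree α} {q : List (Frame α)}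
    {u : BinaryTree α} (h : Represents s g ⟨node x a b, q⟩ u) (hu : IsBST u) :
    Splays [x] 4 u u := by
  obtain ⟨lb, rb, t, p, ht, hp, rfl⟩ := h
  cases ht with
  | node _ ha hb => exact (splays_zip [] hu).mono (List.Sublist.refl _) (by simp)
  | min hb =>
    simp only [finger, hp.leftSpine_eq] at hu ⊢
    cases t with
    | nil => exact (splays_zip [] hu).mono (List.Sublist.refl _) (by simp)
    | node z c d =>
      have h₁ := splays_zip (x := s) [.left z (node (rightSpine g p).1 d (rightSpine g p).2)] hu
      exact (h₁.trans (splays_zip [.right s nil] (h₁.isBST hu))).mono (by simp) (by simp)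
  | max ha =>
    simp only [finger, hp.rightSpine_eq] at hu ⊢
    cases t with
    | nil =>
      have h₁ := splays_zip (x := g) [.right (leftSpine s p).1 (leftSpine s p).2] hu
      exact (h₁.trans (splays_zip [.left g nil] (h₁.isBST hu))).mono (by simp) (by simp)
    | node z c d =>
      have h₁ := splays_zip (x := g) [.right z (node (leftSpine s p).1 (leftSpine s p).2 c)] hu
      exact (h₁.trans (splays_zip [.left g nil] (h₁.isBST hu))).mono (by simp) (by simp)

theorem Represents.serves [LinearOrder α] {s g : α} {T : BinaryTree α} {xs : List α} {R M : ℕ}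
    (hT : Serves T xs R M) {u : BinaryTree α} (h : Represents s g ⟨T, []⟩ u) (hu : IsBST u) :
    ∃ v, Splays xs (18 * (R + M) + 4 * xs.length) u v := by
  induction hT generalizing u with
  | nil => exact ⟨u, (Splays.refl u).mono (List.Sublist.refl _) (by simp)⟩
  | cons h₁ _ ih =>
    obtain ⟨a, b, p, R₁, M₁, R₂, M₂, hr₁, hr₂, rfl, rfl⟩ := h₁
    obtain ⟨v, hv, huv⟩ := h.run hr₁
    have huv := (huv.2 hu).1
    have hacc := hv.access (huv.isBST hu)
    obtain ⟨w, hw, hvw⟩ := hv.run hr₂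
    have hvw := (hvw.2 (huv.isBST hu)).1
    obtain ⟨z, hz⟩ := ih hw (hvw.isBST (huv.isBST hu))
    refine ⟨z, (((huv.trans hacc).trans hvw).trans hz).mono (by simp) ?_⟩
    simp only [List.length_cons]
    omega

/-! ### Repeated queries -/

theorem Run.eq_of_zero {c d : Cursor α} (h : Run c d 0 0) : c = d := by
  cases h; rfl

theorem totalSplayCost_cons_self [LinearOrder α] {x : α} {S : BinaryTree α} (hS : IsBST S)
    (hx : x ∈ keys S)
    (xs : List α) : totalSplayCost S (x :: x :: xs) = totalSplayCost S (x :: xs) := by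
  obtain ⟨a, b, h⟩ := exists_splay_eq_node hS hx
  have h₁ : splayCost x (splay x S) = 0 := by simp [h, splayCost, locate]
  have h₂ : splay x (splay x S) = splay x S := by rw [h]; simp [splay, locate, splayUp]
  simp only [totalSplayCost, h₁, h₂, zero_add]

/-- A search without any operation finds its key at the root. Hence, once immediate repetitions
are dropped, which cost nothing in a splay tree, the number of queries is bounded by the number
of operations. -/
theorem Serves.exists_length_le [LinearOrder α] {T : BinaryTree α} {xs : List α} {R M : ℕ}
    (h : Serves T xs R M) : ∃ xs', Serves T xs' R M ∧
      (∀ S : BinaryTree α, IsBST S → (∀ x ∈ xs, x ∈ keys S) →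
        totalSplayCost S xs = totalSplayCost S xs') ∧
      (xs'.length ≤ 2 * (R + M) ∨ xs'.length ≤ 2 * (R + M) + 1 ∧
        ∃ x a b ys, T = node x a b ∧ xs' = x :: ys) := by
  induction h with
  | nil T => exact ⟨[], .nil T, fun _ _ _ => rfl, by simp⟩
  | @cons T T' x xs R₁ M₁ R₂ M₂ h₁ _ ih =>
    obtain ⟨xs', hs, hc, hl⟩ := ih
    have hc' : ∀ S : BinaryTree α, IsBST S → (∀ y ∈ x :: xs, y ∈ keys S) →
        totalSplayCost S (x :: xs) = totalSplayCost S (x :: xs') := by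
      intro S hS hx
      have hxS : x ∈ keys S := hx x (by simp)
      have hk := keys_splay hS hxS
      simp only [totalSplayCost]
      rw [hc _ (hS.congr hk) (fun y hy => by rw [hk]; exact hx y (by simp [hy]))]
    rcases Nat.eq_zero_or_pos (R₁ + M₁) with h₀ | h₀
    · have hs₁ := h₁
      obtain ⟨a, b, p, R₃, M₃, R₄, M₄, hr₁, hr₂, rfl, rfl⟩ := h₁
      obtain ⟨rfl, rfl, rfl, rfl⟩ : R₃ = 0 ∧ M₃ = 0 ∧ R₄ = 0 ∧ M₄ = 0 := by omega
      have e₁ := hr₁.eq_of_zero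
      have e₂ := hr₂.eq_of_zero
      simp only [Cursor.mk.injEq] at e₁ e₂
      obtain ⟨rfl, rfl⟩ := e₁
      obtain ⟨rfl, -⟩ := e₂
      rcases hl with hl | ⟨hl, y, a', b', ys, hy, rfl⟩
      · exact ⟨x :: xs', .cons hs₁ hs, hc', .inr
          ⟨by simp only [List.length_cons]; omega, x, a, b, xs', rfl, rfl⟩⟩
      · simp only [BinaryTree.node.injEq] at hy
        obtain ⟨rfl, rfl, rfl⟩ := hy
        refine ⟨x :: ys, by simpa using hs, ?_, .inr ⟨by omega, x, a, b, ys, rfl, rfl⟩⟩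
        intro S hS hx
        rw [hc' S hS hx, totalSplayCost_cons_self hS (hx x (by simp))]
    · refine ⟨x :: xs', .cons h₁ hs, hc', .inl ?_⟩
      simp only [List.length_cons]
      rcases hl with hl | hl <;> omega

theorem length_keys (t : BinaryTree α) : (keys t).length = t.numNodes := by
  induction t with
  | nil => rfl
  | node x a b iha ihb => simp [keys, BinaryTree.numNodes, iha, ihb]; omega

theorem RegularAccess.totalSplayCost_le [LinearOrder α] {k l N : ℕ} (h : RegularAccess α k l)
    {S v : BinaryTree α} {xs : List α} (hS : IsBST S) (hv : Splays xs N S v) :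
    totalSplayCost S xs ≤ k * ((l + 1) * N) := by
  obtain ⟨-, ys, hs, hm, -, hN⟩ := hv
  refine (h S xs ys hS hm hs).trans (Nat.mul_le_mul_left k ?_)
  nlinarith [Nat.mul_le_mul_left l (le_of_add_le_left hN), le_of_add_le_right hN]

theorem Run.keys_zip_eq {c d : Cursor α} {R M : ℕ} (h : Run c d R M) :
    keys (zip d.path d.focus) = keys (zip c.path c.focus) := by
  induction h with
  | refl => rfl
  | rotate h _ ih =>
    rw [ih]
    cases h <;> exact keys_zip_congr _ (by simp [Frame.attach, keys])
  | move h _ ih =>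
    rw [ih]
    cases h <;> rfl

theorem Serves.mem_keys {T : BinaryTree α} {xs : List α} {R M : ℕ} (h : Serves T xs R M) :
    ∀ x ∈ xs, x ∈ keys T := by
  induction h with
  | nil => simp
  | cons h₁ _ ih =>
    obtain ⟨a, b, p, R₃, M₃, R₄, M₄, hr₁, hr₂, rfl, rfl⟩ := h₁
    have e₁ := hr₁.keys_zip_eq
    have e₂ := hr₂.keys_zip_eq
    intro y hy
    rcases List.mem_cons.1 hy with rfl | hy
    · exact e₁ ▸ mem_keys_zip p (by simp [keys])
    · exact e₁ ▸ e₂ ▸ ih y hy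

end SplayOpt

theorem mainTheorem1 (k l : ℕ) :
    ∃ C : ℕ, ∀ (α : Type*) [LinearOrder α], SplayOpt.RegularAccess α k l →
      ∀ (n : ℕ), 1 ≤ n →
      ∀ (S T : BinaryTree α), SplayOpt.IsBST S → SplayOpt.IsBST T → S.numNodes = n + 2 →
        (∀ x ∈ SplayOpt.keys T, x ∈ SplayOpt.keys S) →
      ∀ (xs : List α) (R M : ℕ), SplayOpt.Serves T xs R M →
        SplayOpt.totalSplayCost S xs ≤ C * (n + R + M) := by
  open SplayOpt in
  -- Setup costs `118 * (n + 2)`, the service `18 * (R + M)`, and the at most `2 * (R + M) + 1`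
  -- queries cost `4` each; since `1 ≤ n`, the sum is at most `358 * (n + R + M)`.
  refine ⟨k * ((l + 1) * 358), ?_⟩
  intro α _ hreg n hn S T hS hT hSn hTS xs R M hserves
  have hlen : (keys S).length = n + 2 := (length_keys S).trans hSn
  obtain ⟨s, K, g, hkS⟩ : ∃ s K g, keys S = s :: (K ++ [g]) := by
    match h : keys S with
    | [] => simp [h] at hlen
    | s :: L =>
      have hL : L ≠ [] := by rintro rfl; simp [h] at hlen
      exact ⟨s, L.dropLast, L.getLast hL, by rw [List.dropLast_concat_getLast]⟩
  have hKn : K.length = n := by simpa [hkS] using hlen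
  have hK : K ≠ [] := by rintro rfl; simp at hKn; omega
  have hp : (s :: (K ++ [g])).Pairwise (· < ·) := hkS ▸ hS
  obtain ⟨hs, hp⟩ := List.pairwise_cons.1 hp
  obtain ⟨hpK, -, hg⟩ := List.pairwise_append.1 hp
  obtain ⟨t, ht, hkt⟩ := exists_emb (s := s) (g := g) (hs g (by simp)) hT true true hpK
    (fun y hy => hs y (by simp [hy])) (fun y hy => hg y hy g (by simp)) (by
      intro y hy
      have := hTS y hy
      simp only [hkS, List.mem_cons, List.mem_append, List.not_mem_nil, or_false] at this
      tauto)
  have h₁ := exists_splays_finger hS hK hkS hkt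
  obtain ⟨xs', hserves', hcost, hl⟩ := hserves.exists_length_le
  obtain ⟨v, hv⟩ := Represents.serves hserves' ⟨_, _, _, _, ht, .nil, rfl⟩ (h₁.isBST hS)
  rw [hcost S hS (fun x hx => hTS x (hserves.mem_keys x hx)), mul_assoc, mul_assoc]
  refine hreg.totalSplayCost_le hS ((h₁.trans hv).mono (by simp) ?_)
  have : xs'.length ≤ 2 * (R + M) + 1 := by rcases hl with hl | hl <;> omega
  omega
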